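/- Let $P(\lambda)=P_m\lambda^m+\cdots+P_1\lambda+P_0$ be an $n\times n$ complex matrix polynomial with $\det P_m\neq 0$, let $w_0>0$, $w_1,\dots,w_m\ge 0$ be weights and let $\varepsilon\ge 0$. Let $\mathcal B(P,\varepsilon,w)$ be the set of all matrix polynomials $Q(\lambda)=\sum_{j=0}^m (P_j+\Delta_j)\lambda^j$ with $\Delta_j\in\mathbb C^{n\times n}$ and $\|\Delta_j\|\le\varepsilon w_j$ for $j=0,\dots,m$, where $\|\cdot\|$ is the spectral norm (the matrix norm subordinate to the Euclidean norm), and let $$\Lambda_\varepsilon(P)=\{\mu\in\mathbb C:\ \det Q(\mu)=0\ \text{for some}\ Q\in\mathcal B(P,\varepsilon,w)\}$$ be the $\varepsilon$-pseudospectrum of $P$. The (algebraic) multiplicity of an eigenvalue $\mu$ of a matrix polynomial $Q$ is the multiplicity of $\mu$ as a zero of the scalar polynomial $\det Q(\lambda)$; a multiple eigenvalue is one of multiplicity greater than $1$. Suppose that $\Lambda_\varepsilon(P)$ is bounded and that $\mathcal G$ is a connected component of $\Lambda_\varepsilon(P)$. Then $P(\lambda)$ has more than one eigenvalue in $\mathcal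 G$ (counted with multiplicity) if and only if some $Q\in\mathcal B(P,\varepsilon,w)$ has a multiple eigenvalue in $\mathcal G$. -/

import Mathlib

open scoped Matrix.Norms.L2Operator

noncomputable section

namespace MatrixPoly

/-- The coefficients `P 0, …, P m` of an `n × n` complex matrix polynomial
`P(λ) = P m λ ^ m + ⋯ + P 1 λ + P 0` of degree at most `m`. -/
abbrev MPoly (n m : ℕ) : Type := Fin (m + 1) → Matrix (Fin n) (Fin n) ℂ

variable {n m : ℕ}

/-- The value `P(μ)`. -/
def eval (P : MPoly n m) (μ : ℂ) : Matrix (Fin n) (Fin n) ℂ :=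
  ∑ j : Fin (m + 1), μ ^ (j : ℕ) • P j

/-- The scalar polynomial `det P(λ)` in the variable `λ`. -/
def detPoly (P : MPoly n m) : Polynomial ℂ :=
  (∑ j : Fin (m + 1), (Polynomial.X : Polynomial ℂ) ^ (j : ℕ) • (P j).map Polynomial.C).det

/-- `detPoly P` is indeed the polynomial whose value at `μ` is `det P(μ)`. -/
theorem eval_detPoly (P : MPoly n m) (μ : ℂ) :
    (detPoly P).eval μ = (eval P μ).det := by
  unfold detPoly eval
  rw [← Polynomial.coe_evalRingHom, RingHom.map_det]
  congr 1
  ext i k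
  simp only [RingHom.mapMatrix_apply, Matrix.map_apply, Matrix.sum_apply, Matrix.smul_apply, map_sum,
    smul_eq_mul, Polynomial.eval_mul, Polynomial.eval_pow, Polynomial.coe_evalRingHom, Polynomial.eval_X,
    Polynomial.eval_C]

/-- The closed set of admissible perturbations: all `Q` with `‖Q j - P j‖ ≤ ε w j` for every `j`,
in the spectral norm (the operator norm subordinate to the Euclidean norm). -/
def ball (P : MPoly n m) (ε : ℝ) (w : Fin (m + 1) → ℝ) : Set (MPoly n m) :=
  {Q | ∀ j, ‖Q j - P j‖ ≤ ε * w j}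

/-- The `ε`-pseudospectrum of `P` with respect to the weights `w`. -/
def pseudospectrum (P : MPoly n m) (ε : ℝ) (w : Fin (m + 1) → ℝ) : Set ℂ :=
  {μ | ∃ Q ∈ ball P ε w, (eval Q μ).det = 0}

/-- The algebraic multiplicity of `μ` as an eigenvalue of `P`: its multiplicity as a zero of
`det P(λ)`. It is `0` if `μ` is not an eigenvalue, and `⊤` if `det P(λ)` vanishes identically. -/
def algMult (P : MPoly n m) (μ : ℂ) : ℕ∞ :=
  emultiplicity (Polynomial.X - Polynomial.C μ) (detPoly P)

/-- The number of eigenvalues of `P` in `G`, counted with algebraic multiplicity. -/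
def numEigenvalues (P : MPoly n m) (G : Set ℂ) : ℕ∞ :=
  ∑' μ : G, algMult P (μ : ℂ)

/-- `μ` is a multiple eigenvalue of `P`. -/
def IsMultipleEigenvalue (P : MPoly n m) (μ : ℂ) : Prop :=
  1 < algMult P μ

/-- `G` is a connected component of the set `S`. -/
def IsComponentOf (G S : Set ℂ) : Prop :=
  ∃ x ∈ S, G = connectedComponentIn S x

end MatrixPoly

end

noncomputable section

namespace MatrixPoly

open Topology unitInterval

/-! ### Topological lemmas -/

/-! Boundedness of the pseudospectrum Λ makes every admissible leading coefficient nonsingular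
(`det_last_ne_zero_of_isBounded`), so each `Q` in the ball has exactly `n * m` eigenvalues.
Enumerating them gives a compact space `rootSpace` over the ball on which the eigenvalues are
continuous functions.

The ball is convex, hence connected, so the number of eigenvalues of `Q` in a clopen part of Λ does
not depend on `Q`. A component G of the compact set Λ lies in a clopen set containing no further
eigenvalue of `P`; a multiple eigenvalue of some `Q` in G therefore forces two eigenvalues of `P` in
G.

Conversely, suppose that no admissible `Q` has a multiple eigenvalue in G. The multiple eigenvalues
form a closed set missing G, so the eigenpairs (`Q`, z) with z in a suitable clopen neighbourhood of
G form a covering of the ball. The ball contracts to `P`, so a connected set of eigenpairs meets the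
fibre of `P` at most once. The eigenpairs over G are connected (`isPreconnected_eigenpairs`),
because for each μ the set of admissible `Q` singular at μ is connected. Hence `P` has a single,
simple eigenvalue in G. -/

/-- Over a space that contracts to a fixed point `x₀`, a preconnected subset of a covering space
meets the fibre of `x₀` in at most one point. -/
theorem eq_of_isPreconnected_of_isCoveringMap {E X : Type*} [TopologicalSpace E]
    [TopologicalSpace X] {p : E → X} (cov : IsCoveringMap p) (H : C(I × X, X)) {x₀ : X}
    (H_zero : ∀ x, H (0, x) = x) (H_one : ∀ x, H (1, x) = x₀) (H_fix : ∀ t, H (t, x₀) = x₀)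
    {S : Set E} (hS : IsPreconnected S) {a b : E} (ha : a ∈ S) (hb : b ∈ S)
    (hpa : p a = x₀) (hpb : p b = x₀) : a = b := by
  let K : C(I × E, X) := ⟨fun z ↦ H (z.1, p z.2), by have := cov.continuous; fun_prop⟩
  have hK : ∀ e, K (0, e) = p (ContinuousMap.id E e) := fun e ↦ H_zero _
  let L := cov.liftHomotopy K (ContinuousMap.id E) hK
  have hL : ∀ z, p (L z) = K z := fun z ↦ congrFun (cov.liftHomotopy_lifts K _ hK) z
  have hL0 : ∀ e, L (0, e) = e := fun e ↦ cov.liftHomotopy_zero K _ hK e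
  have fix : ∀ e, p e = x₀ → L (1, e) = e := by
    intro e he
    -- Over `x₀` the homotopy is stationary, so this path and the constant path at `e` lift the same
    -- path and agree at time 0.
    have h1 : (fun t ↦ L (t, e)) = fun _ : I ↦ e := by
      refine cov.eq_of_comp_eq (by fun_prop) (by fun_prop) ?_ 0 (hL0 e)
      funext t
      simp only [Function.comp_apply, hL]
      simp [K, he, H_fix]
    exact congrFun h1 1
  have hmem : ∀ e, L (1, e) ∈ p ⁻¹' {x₀} := fun e ↦ by
    simp only [Set.mem_preimage, hL, Set.mem_singleton_iff]
    exact H_one _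
  let g : E → p ⁻¹' {x₀} := fun e ↦ ⟨L (1, e), hmem e⟩
  have hg : Continuous g := by fun_prop
  have : DiscreteTopology (p ⁻¹' {x₀}) := (cov x₀).1
  have := congrArg Subtype.val (hS.constant hg.continuousOn ha hb)
  simpa [g, fix a hpa, fix b hpb] using this

/-- In a compact Hausdorff space, a connected component can be separated from a disjoint closed
set by a clopen set. -/
theorem exists_isClopen_of_disjoint_connectedComponent {X : Type*} [TopologicalSpace X]
    [T2Space X] [CompactSpace X] {x : X} {K : Set X} (hK : IsClosed K)
    (hd : Disjoint K (connectedComponent x)) :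
    ∃ C : Set X, IsClopen C ∧ connectedComponent x ⊆ C ∧ Disjoint K C := by
  have hne : Nonempty { s : Set X // IsClopen s ∧ x ∈ s } := ⟨⟨Set.univ, isClopen_univ, trivial⟩⟩
  rw [connectedComponent_eq_iInter_isClopen, Set.disjoint_iff_inter_eq_empty] at hd
  -- The component is the intersection of a directed family of clopen sets, so by compactness a
  -- single member already misses `K`.
  obtain ⟨⟨C, hC, hx⟩, h⟩ := hK.isCompact.elim_directed_family_closed
    (fun s : { s : Set X // IsClopen s ∧ x ∈ s } ↦ (s : Set X)) (fun s ↦ s.2.1.1) hd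
    (fun a b ↦ ⟨⟨a ∩ b, a.2.1.inter b.2.1, a.2.2, b.2.2⟩, Set.inter_subset_left,
      Set.inter_subset_right⟩)
  exact ⟨C, hC, hC.connectedComponent_subset hx, Set.disjoint_iff_inter_eq_empty.2 h⟩

/-! ### Multivalued functions with continuous branches on a compact parameter space -/

section Branches

variable {T X Y ι : Type*} [TopologicalSpace T] [TopologicalSpace X] [TopologicalSpace Y]
  [CompactSpace T] {q : T → X} {ρ : ι → T → Y}

/-- The graph of the multivalued function with parameter space `T` and branches `ρ i`. -/
def branchGraph (q : T → X) (ρ : ι → T → Y) (C : Set Y) : Set (X × Y) :=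
  {e | (∃ t i, q t = e.1 ∧ ρ i t = e.2) ∧ e.2 ∈ C}

theorem isCompact_branchGraph [Finite ι] (hq : Continuous q) (hρ : ∀ i, Continuous (ρ i)) {C : Set Y}
    (hC : IsClosed C) : IsCompact (branchGraph q ρ C) := by
  have : branchGraph q ρ C =
      (⋃ i, Set.range fun t ↦ (q t, ρ i t)) ∩ (Prod.snd ⁻¹' C) := by
    ext ⟨x, y⟩
    simp only [branchGraph, Set.mem_ofPred_eq, Set.mem_inter_iff, Set.mem_iUnion, Set.mem_range,
      Prod.mk.injEq, Set.mem_preimage]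
    rw [exists_comm]
  rw [this]
  exact (isCompact_iUnion fun i ↦ isCompact_range (by fun_prop)).inter_right
    (hC.preimage continuous_snd)

/-- If the branches are pairwise distinct over the clopen set `C`, then the projection of the part
of the graph over `C` is a covering map. -/
theorem isCoveringMap_branchGraph [Finite ι] [T2Space X] [T2Space Y] (hq : Continuous q) (hρ : ∀ i, Continuous (ρ i))
    (surj : Function.Surjective q) (hr : ∀ t t' i, q t = q t' → ∃ j, ρ j t' = ρ i t) {C : Set Y}
    (hC : IsClopen C) (simple : ∀ t i j, i ≠ j → ρ i t = ρ j t → ρ i t ∉ C) :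
    IsCoveringMap (fun e : branchGraph q ρ C ↦ e.1.1) := by
  have : CompactSpace (branchGraph q ρ C) :=
    isCompact_iff_compactSpace.1 (isCompact_branchGraph hq hρ hC.1)
  set p : branchGraph q ρ C → X := fun e ↦ e.1.1 with hp
  have hpc : Continuous p := by fun_prop
  have hroot : ∀ e ∈ branchGraph q ρ C, ∀ t, q t = e.1 → ∃ i, ρ i t = e.2 := by
    rintro ⟨x, y⟩ ⟨⟨t', i, h1, h2⟩, -⟩ t ht
    obtain ⟨j, hj⟩ := hr t' t i (h1.trans ht.symm)
    exact ⟨j, hj.trans h2⟩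
  have hopen : IsOpenMap p := by
    rw [isOpenMap_iff_nhds_le]
    rintro ⟨⟨x₀, y₀⟩, he⟩ N hN
    rw [Filter.mem_map, nhds_subtype, Filter.mem_comap] at hN
    obtain ⟨N', hN', hsub⟩ := hN
    rw [nhds_prod_eq, Filter.mem_prod_iff] at hN'
    obtain ⟨V, hV, U, hU, hVU⟩ := hN'
    obtain ⟨U', hU'sub, hU'o, hyU'⟩ :=
      mem_nhds_iff.1 (Filter.inter_mem hU (hC.2.mem_nhds he.2))
    -- The base points having a parameter with no branch value in `U'` form the image of a compact
    -- set. It misses `x₀`, since every parameter over `x₀` takes the value `y₀`.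
    have hcl : IsClosed (q '' {t | ∀ i, ρ i t ∉ U'}) := by
      refine (IsClosed.isCompact ?_).image hq |>.isClosed
      simp only [Set.ofPred_forall]
      exact isClosed_iInter fun i ↦ hU'o.isClosed_compl.preimage (hρ i)
    have hx₀ : x₀ ∉ q '' {t | ∀ i, ρ i t ∉ U'} := by
      rintro ⟨t, ht, rfl⟩
      obtain ⟨i, hi⟩ := hroot _ he t rfl
      exact ht i (hi ▸ hyU')
    filter_upwards [hV, hcl.isOpen_compl.mem_nhds hx₀] with x hxV hx
    obtain ⟨t, rfl⟩ := surj x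
    have : ∃ i, ρ i t ∈ U' := by
      by_contra! h
      exact hx ⟨t, h, rfl⟩
    obtain ⟨i, hi⟩ := this
    exact hsub (a := ⟨(q t, ρ i t), ⟨t, i, rfl, rfl⟩, (hU'sub hi).2⟩)
      (hVU ⟨hxV, (hU'sub hi).1⟩)
  -- The graph is compact, so a local homeomorphism suffices. For local injectivity, the closed set
  -- `N` of pairs of values of two different branches avoids (`x₀`, `y₀`, `y₀`) by simplicity.
  rw [← isLocalHomeomorph_iff_isCoveringMap, isLocalHomeomorph_iff_isOpenEmbedding_restrict]
  rintro ⟨⟨x₀, y₀⟩, he⟩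
  let N : Set (X × Y × Y) := ⋃ z : {z : ι × ι // z.1 ≠ z.2},
    Set.range fun t ↦ (q t, ρ z.1.1 t, ρ z.1.2 t)
  have hN : IsClosed N :=
    (isCompact_iUnion fun z ↦ isCompact_range (by fun_prop)).isClosed
  have he' : (x₀, y₀, y₀) ∉ N := by
    simp only [N, Set.mem_iUnion, Set.mem_range, Prod.mk.injEq, Subtype.exists, Prod.exists,
      not_exists]
    rintro i j hij t ⟨rfl, rfl, h⟩
    exact simple t i j hij h.symm he.2
  let φ : branchGraph q ρ C × branchGraph q ρ C → X × Y × Y := fun z ↦ (z.1.1.1, z.1.1.2, z.2.1.2)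
  have hφ : Continuous φ := by fun_prop
  have hφN : φ ⁻¹' Nᶜ ∈ 𝓝 ((⟨(x₀, y₀), he⟩, ⟨(x₀, y₀), he⟩) :
      branchGraph q ρ C × branchGraph q ρ C) :=
    hφ.continuousAt.preimage_mem_nhds (hN.isOpen_compl.mem_nhds he')
  rw [nhds_prod_eq, Filter.mem_prod_same_iff] at hφN
  obtain ⟨U, hU, hUN⟩ := hφN
  obtain ⟨U', hU'U, hU'o, hU'⟩ := mem_nhds_iff.1 hU
  refine ⟨U', hU'o.mem_nhds hU', .of_continuous_injective_isOpenMap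
    (hpc.comp continuous_subtype_val) ?_ (hopen.domRestrict hU'o)⟩
  rintro ⟨⟨⟨x, y⟩, h1⟩, h1'⟩ ⟨⟨⟨x', y'⟩, h2⟩, h2'⟩ (h : x = x')
  subst h
  obtain ⟨t, rfl⟩ := surj x
  obtain ⟨i, hi⟩ := hroot _ h1 t rfl
  obtain ⟨j, hj⟩ := hroot _ h2 t rfl
  dsimp only at hi hj
  subst hi hj
  have hij : i = j := by
    by_contra hij
    refine hUN (a := (⟨(q t, ρ i t), h1⟩, ⟨(q t, ρ j t), h2⟩)) ⟨hU'U h1', hU'U h2'⟩ ?_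
    exact Set.mem_iUnion.2 ⟨⟨(i, j), hij⟩, t, rfl⟩
  subst hij
  rfl

/-- The number of branches with values in a clopen set is the same over all points of a
preconnected base. -/
theorem apply_eq_of_sum_indicator_branches [Fintype ι] [T2Space X] [PreconnectedSpace X]
    (hq : Continuous q) (hρ : ∀ i, Continuous (ρ i)) (surj : Function.Surjective q) {C : Set Y}
    (hC : IsClopen C) {N : X → ℕ} (hN : ∀ t, N (q t) = ∑ i, C.indicator 1 (ρ i t)) (x y : X) :
    N x = N y := by
  have hcont : Continuous N := by
    -- As `q` is a quotient map, continuity can be tested on `T`, where the branches are available.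
    rw [(hq.isClosedMap.isQuotientMap hq surj).continuous_iff]
    have : N ∘ q = fun t ↦ ∑ i, C.indicator (1 : Y → ℕ) (ρ i t) := funext hN
    rw [this]
    exact continuous_finsetSum _ fun i _ ↦ (hC.continuous_indicator continuous_one).comp (hρ i)
  exact (IsLocallyConstant.iff_continuous _).2 hcont |>.apply_eq_of_preconnectedSpace x y

end Branches

end MatrixPoly

end

noncomputable section

namespace MatrixPoly

open Topology

variable {n m : ℕ}

/-! ### The determinant polynomial -/

theorem natDegree_entry_le (P : MPoly n m) (i k : Fin n) :
    ((∑ j : Fin (m + 1), (Polynomial.X : Polynomial ℂ) ^ (j : ℕ) • (P j).map Polynomial.C) i k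
      ).natDegree ≤ m := by
  simp only [Matrix.sum_apply, Matrix.smul_apply, Matrix.map_apply, smul_eq_mul]
  refine Polynomial.natDegree_sum_le_of_forall_le _ _ fun j _ ↦ ?_
  rw [mul_comm]
  exact (Polynomial.natDegree_C_mul_X_pow_le _ _).trans (Nat.lt_succ_iff.1 j.2)

theorem coeff_entry (P : MPoly n m) (i k : Fin n) :
    ((∑ j : Fin (m + 1), (Polynomial.X : Polynomial ℂ) ^ (j : ℕ) • (P j).map Polynomial.C) i k
      ).coeff m = P (Fin.last m) i k := by
  simp only [Matrix.sum_apply, Matrix.smul_apply, Matrix.map_apply, smul_eq_mul,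
    Polynomial.finsetSum_coeff, mul_comm (Polynomial.X ^ _), Polynomial.coeff_C_mul_X_pow]
  rw [Finset.sum_eq_single (Fin.last m)]
  · simp
  · intro j _ hj
    rw [if_neg]
    intro h
    exact hj (Fin.ext (by simpa using h.symm))
  · simp

theorem natDegree_detPoly_le (P : MPoly n m) : (detPoly P).natDegree ≤ n * m := by
  rw [detPoly, Matrix.det_apply]
  refine Polynomial.natDegree_sum_le_of_forall_le _ _ fun σ _ ↦ ?_
  refine (Polynomial.natDegree_smul_le _ _).trans ((Polynomial.natDegree_prod_le _ _).trans ?_)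
  refine (Finset.sum_le_card_nsmul _ _ m fun i _ ↦ natDegree_entry_le P _ _).trans ?_
  simp

theorem coeff_detPoly (P : MPoly n m) : (detPoly P).coeff (n * m) = (P (Fin.last m)).det := by
  rw [detPoly, Matrix.det_apply, Matrix.det_apply, Polynomial.finsetSum_coeff]
  refine Finset.sum_congr rfl fun σ _ ↦ ?_
  rw [Polynomial.coeff_smul]
  congr 1
  have := Polynomial.coeff_prod_of_natDegree_le (s := Finset.univ)
    (fun i ↦ (∑ j : Fin (m + 1), (Polynomial.X : Polynomial ℂ) ^ (j : ℕ) •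
      (P j).map Polynomial.C) (σ i) i) m fun i _ ↦ natDegree_entry_le P _ _
  rw [Finset.card_univ, Fintype.card_fin] at this
  rw [this]
  exact Finset.prod_congr rfl fun i _ ↦ coeff_entry P _ _

theorem detPoly_ne_zero {P : MPoly n m} (h : (P (Fin.last m)).det ≠ 0) : detPoly P ≠ 0 := by
  intro h0
  rw [← coeff_detPoly, h0, Polynomial.coeff_zero] at h
  exact h rfl

/-- The product form of `det P(λ)`. -/
def IsRootVector (P : MPoly n m) (r : Fin (n * m) → ℂ) : Prop :=
  ∀ z, (eval P z).det = (P (Fin.last m)).det * ∏ i, (z - r i)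

theorem exists_isRootVector {P : MPoly n m} (h : (P (Fin.last m)).det ≠ 0) :
    ∃ r, IsRootVector P r := by
  have hdeg : (detPoly P).natDegree = n * m :=
    Polynomial.natDegree_eq_of_le_of_coeff_ne_zero (natDegree_detPoly_le P)
      (by rwa [coeff_detPoly])
  have hlc : (detPoly P).leadingCoeff = (P (Fin.last m)).det := by
    rw [Polynomial.leadingCoeff, hdeg, coeff_detPoly]
  have hs := IsAlgClosed.splits (detPoly P)
  have hcard : (detPoly P).roots.toList.length = n * m := by
    rw [Multiset.length_toList, ← hdeg, hs.natDegree_eq_card_roots]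
  refine ⟨fun i ↦ (detPoly P).roots.toList.get (i.cast hcard.symm), fun z ↦ ?_⟩
  have h1 := congrArg (Polynomial.eval z) hs.eq_prod_roots
  rw [eval_detPoly, hlc] at h1
  rw [h1, Polynomial.eval_mul, Polynomial.eval_C, Polynomial.eval_multiset_prod, Multiset.map_map]
  congr 1
  conv_lhs => rw [← Multiset.coe_toList (detPoly P).roots]
  rw [Multiset.map_coe, Multiset.prod_coe, ← Fin.prod_univ_getElem]
  simp only [List.getElem_map]
  refine Fintype.prod_equiv (finCongr (by simpa using hcard)) _ _ fun i ↦ ?_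
  simp

theorem IsRootVector.detPoly_eq {P : MPoly n m} {r : Fin (n * m) → ℂ} (h : IsRootVector P r) :
    detPoly P = Polynomial.C (P (Fin.last m)).det *
      ∏ i, (Polynomial.X - Polynomial.C (r i)) := by
  refine Polynomial.funext fun z ↦ ?_
  rw [eval_detPoly, h z]
  simp [Polynomial.eval_prod]

theorem IsRootVector.roots_eq {P : MPoly n m} {r : Fin (n * m) → ℂ} (h : IsRootVector P r)
    (hP : (P (Fin.last m)).det ≠ 0) : (detPoly P).roots = Finset.univ.val.map r := by
  rw [h.detPoly_eq, Polynomial.roots_C_mul _ hP, Finset.prod_eq_multiset_prod]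
  exact Polynomial.roots_multiset_prod_X_sub_C (Finset.univ.val.map r) ▸ by
    rw [Multiset.map_map]; rfl

theorem IsRootVector.det_eval_eq_zero_iff {P : MPoly n m} {r : Fin (n * m) → ℂ}
    (h : IsRootVector P r) (hP : (P (Fin.last m)).det ≠ 0) (z : ℂ) :
    (eval P z).det = 0 ↔ ∃ i, r i = z := by
  rw [h z, mul_eq_zero, or_iff_right hP, Finset.prod_eq_zero_iff]
  simp [sub_eq_zero, eq_comm]

theorem IsRootVector.isMultipleEigenvalue {P : MPoly n m} {r : Fin (n * m) → ℂ}
    (h : IsRootVector P r) {i j : Fin (n * m)} (hij : i ≠ j) (hr : r i = r j) :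
    IsMultipleEigenvalue P (r i) := by
  have hd : (Polynomial.X - Polynomial.C (r i)) ^ 2 ∣ detPoly P := by
    rw [h.detPoly_eq]
    refine Dvd.dvd.mul_left ?_ _
    have := Finset.prod_dvd_prod_of_subset {i, j} Finset.univ
      (fun i ↦ Polynomial.X - Polynomial.C (r i)) (Finset.subset_univ _)
    rwa [Finset.prod_pair hij, ← hr, ← sq] at this
  have := le_emultiplicity_of_pow_dvd hd
  exact lt_of_lt_of_le (by norm_num) this

theorem algMult_eq_count {P : MPoly n m} (hP : (P (Fin.last m)).det ≠ 0) (z : ℂ) :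
    algMult P z = ((detPoly P).roots.count z : ℕ∞) := by
  rw [algMult, Polynomial.count_roots, Polynomial.rootMultiplicity_eq_multiplicity,
    if_neg (detPoly_ne_zero hP)]
  exact (Polynomial.finiteMultiplicity_X_sub_C z (detPoly_ne_zero hP)).emultiplicity_eq_multiplicity

open Classical in
theorem numEigenvalues_eq_card {P : MPoly n m} (hP : (P (Fin.last m)).det ≠ 0) (G : Set ℂ) :
    numEigenvalues P G = (((detPoly P).roots.filter (· ∈ G)).card : ℕ∞) := by
  rw [numEigenvalues, tsum_subtype G (algMult P), tsum_eq_sum (s := (detPoly P).roots.toFinset),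
    ← Multiset.toFinset_sum_count_eq, Multiset.toFinset_filter, Nat.cast_sum, Finset.sum_filter]
  · refine Finset.sum_congr rfl fun z _ ↦ ?_
    by_cases hz : z ∈ G
    · simp [hz, algMult_eq_count hP]
    · simp [hz]
  · intro z hz
    have : algMult P z = 0 := by
      rw [algMult_eq_count hP, Multiset.count_eq_zero_of_notMem (by simpa using hz)]
      rfl
    simp [Set.indicator, this]

open Classical in
theorem IsRootVector.numEigenvalues_eq {P : MPoly n m} {r : Fin (n * m) → ℂ}
    (h : IsRootVector P r) (hP : (P (Fin.last m)).det ≠ 0) (G : Set ℂ) :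
    numEigenvalues P G = ((Finset.univ.filter (r · ∈ G)).card : ℕ∞) := by
  rw [numEigenvalues_eq_card hP, h.roots_eq hP, Multiset.filter_map, Multiset.card_map]
  rfl

/-! ### Boundedness forces nonsingular leading coefficients -/

theorem continuous_eval : Continuous fun x : MPoly n m × ℂ ↦ eval x.1 x.2 := by
  unfold eval
  fun_prop

theorem continuous_det_eval : Continuous fun x : MPoly n m × ℂ ↦ (eval x.1 x.2).det :=
  continuous_eval.matrix_det

theorem convex_ball (P : MPoly n m) (ε : ℝ) (w : Fin (m + 1) → ℝ) : Convex ℝ (ball P ε w) := by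
  have : ball P ε w = Set.univ.pi fun j ↦ Metric.closedBall (P j) (ε * w j) := by
    ext Q; simp [ball, dist_eq_norm]
  rw [this]
  exact convex_pi fun j _ ↦ convex_closedBall _ _

theorem isCompact_ball (P : MPoly n m) (ε : ℝ) (w : Fin (m + 1) → ℝ) :
    IsCompact (ball P ε w) := by
  have : ball P ε w = Set.univ.pi fun j ↦ Metric.closedBall (P j) (ε * w j) := by
    ext Q; simp [ball, dist_eq_norm]
  rw [this]
  have : ProperSpace (Matrix (Fin n) (Fin n) ℂ) := FiniteDimensional.proper ℂ _
  exact isCompact_univ_pi fun j ↦ isCompact_closedBall _ _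

theorem mem_ball_self (P : MPoly n m) {ε : ℝ} {w : Fin (m + 1) → ℝ} (hε : 0 ≤ ε)
    (hw : ∀ j, 0 ≤ w j) : P ∈ ball P ε w := fun j ↦ by
  simpa using mul_nonneg hε (hw j)

/-- Approach a `Q` with singular leading coefficient along the segment from `P`. The leading
determinant tends to 0 while the eigenvalues stay bounded by `R`, so the product formula gives det
`Q`(z) = 0 for every z, and the pseudospectrum would be the whole plane. -/
theorem det_last_ne_zero_of_isBounded {P : MPoly n m} (hP : (P (Fin.last m)).det ≠ 0)
    {w : Fin (m + 1) → ℝ} (hw : ∀ j, 0 ≤ w j) {ε : ℝ} (hε : 0 ≤ ε)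
    (hbdd : Bornology.IsBounded (pseudospectrum P ε w)) {Q : MPoly n m} (hQ : Q ∈ ball P ε w) :
    (Q (Fin.last m)).det ≠ 0 := by
  intro hQ0
  obtain ⟨R, hR⟩ := hbdd.exists_norm_le
  let F : ℝ → MPoly n m := fun t ↦ AffineMap.lineMap P Q t
  have hF : Continuous F := AffineMap.lineMap_continuous
  have hF1 : F 1 = Q := AffineMap.lineMap_apply_one _ _
  have hFb : ∀ t ∈ Set.Icc (0 : ℝ) 1, F t ∈ ball P ε w := fun t ht ↦
    (convex_ball P ε w).lineMap_mem (mem_ball_self P hε hw) hQ ht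
  let g : ℝ → ℂ := fun t ↦ (F t (Fin.last m)).det
  have hg : Continuous g := ((continuous_apply _).comp hF).matrix_det
  -- The leading determinant along the segment is a polynomial in t, nonzero at t = 0, so it has
  -- finitely many zeros.
  let p : Polynomial ℂ := (Matrix.map (P (Fin.last m)) Polynomial.C +
    (Polynomial.X : Polynomial ℂ) • Matrix.map (Q (Fin.last m) - P (Fin.last m)) Polynomial.C).det
  have hp : ∀ t : ℝ, p.eval (t : ℂ) = g t := by
    intro t
    simp only [p, g, F]
    rw [← Polynomial.coe_evalRingHom, RingHom.map_det]
    congr 1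
    ext i k
    simp [AffineMap.lineMap_apply]
    ring
  have hp0 : p ≠ 0 := by
    intro h
    have := hp 0
    rw [h] at this
    simp only [Polynomial.eval_zero, g, F, AffineMap.lineMap_apply_zero] at this
    exact hP this.symm
  have hfin : {t : ℝ | g t = 0}.Finite := by
    have : {t : ℝ | g t = 0} ⊆ (fun t : ℝ ↦ (t : ℂ)) ⁻¹' (p.roots.toFinset : Set ℂ) := by
      intro t (ht : g t = 0)
      simp [hp0, hp, ht]
    exact ((Finset.finite_toSet _).preimage (Complex.ofReal_injective.injOn)).subset this
  have hev : ∀ᶠ t in 𝓝[<] (1 : ℝ), g t ≠ 0 ∧ t ∈ Set.Icc (0 : ℝ) 1 := by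
    have h1 : ∀ᶠ t in 𝓝[<] (1 : ℝ), g t ≠ 0 := by
      have := (hfin.subset (Set.sdiff_subset (t := {1}))).isClosed.isOpen_compl.mem_nhds
        (x := (1 : ℝ)) (by simp)
      filter_upwards [mem_nhdsWithin_of_mem_nhds this, self_mem_nhdsWithin] with t ht ht1 h0
      exact ht ⟨h0, ne_of_lt ht1⟩
    filter_upwards [h1, Ioo_mem_nhdsLT (zero_lt_one' ℝ)] with t ht ht'
    exact ⟨ht, Set.Ioo_subset_Icc_self ht'⟩
  have hz : ∀ z, (eval Q z).det = 0 := by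
    intro z
    have hle : ∀ᶠ t in 𝓝[<] (1 : ℝ), ‖(eval (F t) z).det‖ ≤ ‖g t‖ * (‖z‖ + R) ^ (n * m) := by
      filter_upwards [hev] with t ⟨ht, htI⟩
      obtain ⟨r, hr⟩ := exists_isRootVector ht
      rw [hr z, norm_mul, norm_prod]
      refine mul_le_mul_of_nonneg_left ?_ (norm_nonneg _)
      have : ∀ i ∈ Finset.univ, ‖z - r i‖ ≤ ‖z‖ + R := fun i _ ↦ by
        refine (norm_sub_le _ _).trans (add_le_add_right (hR _ ?_) _)
        exact ⟨F t, hFb t htI, (hr.det_eval_eq_zero_iff ht _).2 ⟨i, rfl⟩⟩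
      refine (Finset.prod_le_prod (fun _ _ ↦ norm_nonneg _) this).trans ?_
      simp
    have h1 : Filter.Tendsto (fun t ↦ ‖(eval (F t) z).det‖) (𝓝[<] 1) (𝓝 ‖(eval (F 1) z).det‖) :=
      ((continuous_det_eval.comp (hF.prodMk continuous_const)).norm.tendsto 1).mono_left
        nhdsWithin_le_nhds
    have h2 : Filter.Tendsto (fun t ↦ ‖g t‖ * (‖z‖ + R) ^ (n * m)) (𝓝[<] 1)
        (𝓝 (‖g 1‖ * (‖z‖ + R) ^ (n * m))) :=
      ((hg.norm.mul continuous_const).tendsto 1).mono_left nhdsWithin_le_nhds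
    have h3 := le_of_tendsto_of_tendsto h1 h2 hle
    have hg1 : g 1 = 0 := by simp only [g, hF1, hQ0]
    rw [hg1, norm_zero, zero_mul, hF1] at h3
    exact norm_le_zero_iff.1 h3
  have : pseudospectrum P ε w = Set.univ := Set.eq_univ_of_forall fun z ↦ ⟨Q, hQ, hz z⟩
  rw [this] at hbdd
  exact NoncompactSpace.noncompact_univ (X := ℂ) (Metric.isCompact_of_isClosed_isBounded
    isClosed_univ hbdd)

end MatrixPoly

end

noncomputable section

namespace MatrixPoly

open Topology InnerProductSpace

variable {n m : ℕ}

/-! ### Connectedness of the set of perturbations with a prescribed eigenvalue -/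

section SingularVector

variable {H : Type*} [NormedAddCommGroup H] [InnerProductSpace ℂ H]

/-- A right singular vector for the smallest singular value `√s`. -/
theorem exists_min_singular_vector [FiniteDimensional ℂ H] [Nontrivial H] (A : H →L[ℂ] H) :
    ∃ v : H, ‖v‖ = 1 ∧ ∃ s : ℝ, (∀ x, s * ‖x‖ ^ 2 ≤ ‖A x‖ ^ 2) ∧
      ∀ x, RCLike.re (inner ℂ (A x) (A v)) = s * RCLike.re (inner ℂ x v) := by
  have : ProperSpace H := FiniteDimensional.proper ℂ H
  have : CompleteSpace H := FiniteDimensional.complete ℂ H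
  obtain ⟨v₁, hv₁⟩ := NormedSpace.sphere_nonempty (x := (0 : H)) (r := 1) |>.2 zero_le_one
  obtain ⟨v, hv, hmin⟩ := (isCompact_sphere (0 : H) 1).exists_isMinOn ⟨v₁, hv₁⟩
    (A.continuous.norm.pow 2).continuousOn
  have hv1 : ‖v‖ = 1 := by simpa using hv
  let T : H →L[ℂ] H := (ContinuousLinearMap.adjoint A).comp A
  have hT : IsSelfAdjoint T := by
    simpa [T] using ContinuousLinearMap.IsPositive.isSelfAdjoint
      (ContinuousLinearMap.isPositive_adjoint_comp_self A)
  have hTx : ∀ x y, inner ℂ x (T y) = inner ℂ (A x) (A y) := fun x y ↦ by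
    simp [T, ContinuousLinearMap.adjoint_inner_right]
  have hre : ∀ x, T.reApplyInnerSelf x = ‖A x‖ ^ 2 := fun x ↦ by
    rw [ContinuousLinearMap.reApplyInnerSelf_apply, ← inner_re_symm, hTx, ← norm_sq_eq_re_inner]
  have hv0 : v ≠ 0 := by
    intro h
    simp [h] at hv1
  -- A minimiser of the Rayleigh quotient of the self-adjoint operator A*A is an eigenvector.
  have hext : IsMinOn T.reApplyInnerSelf (Metric.sphere 0 ‖v‖) v := by
    rw [hv1]
    intro x hx
    simpa [hre] using hmin hx
  have heig := hT.hasEigenvector_of_isMinOn hv0 hext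
  set s : ℝ := ⨅ x : { x : H // x ≠ 0 }, T.rayleighQuotient x with hs
  have hTv : T v = (s : ℂ) • v := heig.apply_eq_smul
  have hre' : ∀ x, RCLike.re (inner ℂ (A x) (A v)) = s * RCLike.re (inner ℂ x v) := fun x ↦ by
    rw [← hTx, hTv, inner_smul_right]
    simp
  refine ⟨v, hv1, s, fun x ↦ ?_, hre'⟩
  have hAv : ‖A v‖ ^ 2 = s := by
    have := hre' v
    rwa [← norm_sq_eq_re_inner, ← norm_sq_eq_re_inner, hv1, one_pow, mul_one] at this
  rcases eq_or_ne x 0 with rfl | hx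
  · simp
  · have hx' : ‖x‖ ≠ 0 := norm_ne_zero_iff.2 hx
    have h1 : ((‖x‖⁻¹ : ℝ) : ℂ) • x ∈ Metric.sphere (0 : H) 1 := by
      simp [norm_smul, hx']
    have h2 : ‖A v‖ ^ 2 ≤ ‖A (((‖x‖⁻¹ : ℝ) : ℂ) • x)‖ ^ 2 := hmin h1
    rw [hAv, map_smul, norm_smul, mul_pow] at h2
    simp only [Complex.norm_real, norm_inv, norm_norm] at h2
    have hpos : 0 < ‖x‖ ^ 2 := by positivity
    calc s * ‖x‖ ^ 2 ≤ (‖x‖⁻¹ ^ 2 * ‖A x‖ ^ 2) * ‖x‖ ^ 2 := by gcongr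
      _ = ‖A x‖ ^ 2 := by field_simp

/-- The sublevel set of `‖A x‖ / ‖x‖` contains the segment from any of its points to a minimal
singular vector on the same side. -/
theorem norm_apply_segment_le {A : H →L[ℂ] H} {v : H} (hv : ‖v‖ = 1) {s : ℝ}
    (hmin : ∀ x, s * ‖x‖ ^ 2 ≤ ‖A x‖ ^ 2)
    (hre : ∀ x, RCLike.re (inner ℂ (A x) (A v)) = s * RCLike.re (inner ℂ x v))
    {x : H} (hx : x ≠ 0) (hxv : 0 ≤ RCLike.re (inner ℂ x v)) {r : ℝ} (hr : 0 ≤ r)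
    (hxr : ‖A x‖ ≤ r * ‖x‖) {z : H} (hz : z ∈ segment ℝ x v) :
    z ≠ 0 ∧ ‖A z‖ ≤ r * ‖z‖ := by
  obtain ⟨a, b, ha, hb, hab, rfl⟩ := hz
  have key : ∀ x y : H, ‖a • x + b • y‖ ^ 2 =
      a ^ 2 * ‖x‖ ^ 2 + 2 * (a * b) * RCLike.re (inner ℂ x y) + b ^ 2 * ‖y‖ ^ 2 := by
    intro x y
    rw [@norm_add_sq ℂ, norm_smul, norm_smul, ← Complex.coe_smul a x, ← Complex.coe_smul b y,
      inner_smul_left, inner_smul_right]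
    simp only [mul_pow, Real.norm_eq_abs, sq_abs, Complex.conj_ofReal, RCLike.re_to_complex,
      Complex.re_ofReal_mul]
    ring
  have hAv : ‖A v‖ ^ 2 = s := by
    have := hre v
    rwa [← norm_sq_eq_re_inner, ← norm_sq_eq_re_inner, hv, one_pow, mul_one] at this
  have hA : A (a • x + b • v) = a • A x + b • A v := by
    rw [← Complex.coe_smul a x, ← Complex.coe_smul b v, map_add, map_smul, map_smul,
      Complex.coe_smul, Complex.coe_smul]
  have hxpos : 0 < ‖x‖ ^ 2 := by positivity
  have hxr2 : ‖A x‖ ^ 2 ≤ r ^ 2 * ‖x‖ ^ 2 := by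
    rw [← mul_pow]
    gcongr
  have hsr : s ≤ r ^ 2 := le_of_mul_le_mul_right ((hmin x).trans hxr2) hxpos
  constructor
  · intro h0
    have h1 := key x v
    rw [h0, norm_zero, hv] at h1
    have h2 : 0 ≤ 2 * (a * b) * RCLike.re (inner ℂ x v) := by positivity
    have h3 : 0 ≤ a ^ 2 * ‖x‖ ^ 2 := by positivity
    have h4 : b = 0 := by
      have : b ^ 2 ≤ 0 := by nlinarith
      exact pow_eq_zero_iff two_ne_zero |>.1 (le_antisymm this (sq_nonneg b))
    have h5 : a = 1 := by linarith
    rw [h4, h5] at h1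
    simp only [ne_eq, OfNat.ofNat_ne_zero, not_false_eq_true, zero_pow, one_pow] at h1
    linarith
  · rw [hA]
    refine le_of_sq_le_sq ?_ (by positivity)
    -- The cross term of ‖Az‖² is `s` times that of ‖z‖², so `s ≤ r ^ 2` allows a term by term
    -- comparison.
    rw [mul_pow, key, key, hre, hAv, hv]
    have h1 : 2 * (a * b) * (s * RCLike.re (inner ℂ x v)) ≤
        2 * (a * b) * (r ^ 2 * RCLike.re (inner ℂ x v)) := by gcongr
    have h2 : a ^ 2 * ‖A x‖ ^ 2 ≤ a ^ 2 * (r ^ 2 * ‖x‖ ^ 2) := by gcongr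
    have h3 : b ^ 2 * s ≤ b ^ 2 * r ^ 2 := by gcongr
    linarith

end SingularVector

/-! ### Kernel vectors of admissible perturbations -/

open Matrix (toEuclideanCLM)

/-- The operator of multiplication by a matrix on Euclidean space. -/
abbrev toOp (M : Matrix (Fin n) (Fin n) ℂ) : EuclideanSpace ℂ (Fin n) →L[ℂ] EuclideanSpace ℂ (Fin n) :=
  toEuclideanCLM (n := Fin n) (𝕜 := ℂ) M

theorem det_eq_zero_iff_exists_toOp (M : Matrix (Fin n) (Fin n) ℂ) :
    M.det = 0 ↔ ∃ x, x ≠ 0 ∧ toOp M x = 0 := by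
  rw [← Matrix.exists_mulVec_eq_zero_iff]
  constructor
  · rintro ⟨v, hv, h⟩
    refine ⟨WithLp.toLp 2 v, by simpa using hv, ?_⟩
    rw [toOp, Matrix.toEuclideanCLM_toLp, h]
    rfl
  · rintro ⟨x, hx, h⟩
    refine ⟨WithLp.ofLp x, by simpa using hx, ?_⟩
    rw [← Matrix.ofLp_toEuclideanCLM, h]
    rfl

theorem toOp_eval (Q : MPoly n m) (μ : ℂ) (x : EuclideanSpace ℂ (Fin n)) :
    toOp (eval Q μ) x = ∑ j : Fin (m + 1), μ ^ (j : ℕ) • toOp (Q j) x := by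
  simp [eval, toOp, map_sum]

/-- The radius `w(|μ|) = ∑ j, w j |μ| ^ j` of the perturbations of `P(μ)`. -/
def weight (w : Fin (m + 1) → ℝ) (μ : ℂ) : ℝ := ∑ j, w j * ‖μ‖ ^ (j : ℕ)

theorem weight_pos {w : Fin (m + 1) → ℝ} (hw : ∀ j, 0 ≤ w j) (hw0 : 0 < w 0) (μ : ℂ) :
    0 < weight w μ := by
  refine Finset.sum_pos' (fun j _ ↦ mul_nonneg (hw j) (by positivity)) ⟨0, Finset.mem_univ _, ?_⟩
  simpa using hw0

/-- This bound characterises the kernel vectors at μ of admissible perturbations;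
`rankOnePerturbation` supplies the converse. -/
theorem norm_toOp_eval_le {P Q : MPoly n m} {ε : ℝ} {w : Fin (m + 1) → ℝ} (hQ : Q ∈ ball P ε w)
    {μ : ℂ} {x : EuclideanSpace ℂ (Fin n)} (hx : toOp (eval Q μ) x = 0) :
    ‖toOp (eval P μ) x‖ ≤ ε * weight w μ * ‖x‖ := by
  have h : toOp (eval P μ) x = -∑ j : Fin (m + 1), μ ^ (j : ℕ) • toOp (Q j - P j) x := by
    rw [← sub_eq_zero, sub_neg_eq_add, ← hx, toOp_eval, toOp_eval, ← Finset.sum_add_distrib]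
    refine Finset.sum_congr rfl fun j _ ↦ ?_
    rw [← smul_add]
    simp [toOp]
  rw [h, norm_neg, weight, Finset.mul_sum, Finset.sum_mul]
  refine norm_sum_le_of_le _ fun j _ ↦ ?_
  rw [norm_smul, norm_pow]
  have h1 : ‖toOp (Q j - P j) x‖ ≤ ε * w j * ‖x‖ :=
    ((toOp (Q j - P j)).le_opNorm x).trans (by gcongr; exact hQ j)
  calc ‖μ‖ ^ (j : ℕ) * ‖toOp (Q j - P j) x‖ ≤ ‖μ‖ ^ (j : ℕ) * (ε * w j * ‖x‖) := by gcongr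
    _ = _ := by ring

/-- The perturbation of `P` of rank one in each coefficient that makes `x` a kernel vector
at `μ`. -/
def rankOnePerturbation (P : MPoly n m) (w : Fin (m + 1) → ℝ) (μ : ℂ)
    (x : EuclideanSpace ℂ (Fin n)) : MPoly n m := fun j ↦
  -- The correction of P(μ)x is shared in proportion to `w j * ‖μ‖ ^ j`, and the phase factor
  -- cancels the argument of μ ^ j. At μ = 0 with j > 0 that factor is 0 / 0 = 0, harmlessly.
  P j - ((w j / weight w μ : ℝ) * (star (μ ^ (j : ℕ)) / (‖μ‖ ^ (j : ℕ) : ℝ)) *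
    ((‖x‖ ^ 2)⁻¹ : ℝ) : ℂ) •
    (toEuclideanCLM (n := Fin n) (𝕜 := ℂ)).symm (rankOne ℂ (toOp (eval P μ) x) x)

theorem rankOnePerturbation_mem_ball {P : MPoly n m} {ε : ℝ} {w : Fin (m + 1) → ℝ}
    (hw : ∀ j, 0 ≤ w j) (hw0 : 0 < w 0) {μ : ℂ} {x : EuclideanSpace ℂ (Fin n)}
    (hx : x ≠ 0) (h : ‖toOp (eval P μ) x‖ ≤ ε * weight w μ * ‖x‖) :
    rankOnePerturbation P w μ x ∈ ball P ε w := by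
  intro j
  have hW := weight_pos hw hw0 μ
  have hx' : 0 < ‖x‖ := norm_pos_iff.2 hx
  have h1 : ‖star (μ ^ (j : ℕ)) / ((‖μ‖ ^ (j : ℕ) : ℝ) : ℂ)‖ ≤ 1 := by
    rw [norm_div, norm_star, norm_pow, Complex.norm_real, norm_pow, norm_norm]
    exact div_self_le_one _
  have h2 : ‖(toEuclideanCLM (n := Fin n) (𝕜 := ℂ)).symm (rankOne ℂ (toOp (eval P μ) x) x)‖ =
      ‖toOp (eval P μ) x‖ * ‖x‖ := by
    rw [Matrix.cstar_norm_def, StarAlgEquiv.apply_symm_apply, norm_rankOne]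
  rw [rankOnePerturbation, sub_sub_cancel_left, norm_neg, norm_smul, norm_mul, norm_mul, h2,
    Complex.norm_real, Complex.norm_real, Real.norm_of_nonneg (div_nonneg (hw j) hW.le),
    Real.norm_of_nonneg (by positivity)]
  calc w j / weight w μ * ‖star (μ ^ (j : ℕ)) / ((‖μ‖ ^ (j : ℕ) : ℝ) : ℂ)‖ * (‖x‖ ^ 2)⁻¹ *
        (‖toOp (eval P μ) x‖ * ‖x‖)
      ≤ w j / weight w μ * 1 * (‖x‖ ^ 2)⁻¹ * (ε * weight w μ * ‖x‖ * ‖x‖) := by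
        have := hw j
        gcongr
    _ = ε * w j := by field_simp

theorem toOp_eval_rankOnePerturbation {P : MPoly n m} {w : Fin (m + 1) → ℝ}
    (hw : ∀ j, 0 ≤ w j) (hw0 : 0 < w 0) {μ : ℂ} {x : EuclideanSpace ℂ (Fin n)} (hx : x ≠ 0) :
    toOp (eval (rankOnePerturbation P w μ x) μ) x = 0 := by
  have hW := (weight_pos hw hw0 μ).ne'
  have hx' : (‖x‖ : ℂ) ≠ 0 := by simpa using hx
  have hj : ∀ j : Fin (m + 1), μ ^ (j : ℕ) • toOp (rankOnePerturbation P w μ x j) x =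
      μ ^ (j : ℕ) • toOp (P j) x -
        ((w j * ‖μ‖ ^ (j : ℕ) / weight w μ : ℝ) : ℂ) • toOp (eval P μ) x := by
    intro j
    have h1 : μ ^ (j : ℕ) * (star (μ ^ (j : ℕ)) / ((‖μ‖ ^ (j : ℕ) : ℝ) : ℂ)) =
        ((‖μ‖ ^ (j : ℕ) : ℝ) : ℂ) := by
      rw [← mul_div_assoc, Complex.star_def, Complex.mul_conj', norm_pow, Complex.ofReal_pow, sq,
        mul_self_div_self]
    have h2 : toOp (rankOnePerturbation P w μ x j) x = toOp (P j) x -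
        ((w j / weight w μ : ℝ) * (star (μ ^ (j : ℕ)) / (‖μ‖ ^ (j : ℕ) : ℝ)) *
          ((‖x‖ ^ 2)⁻¹ : ℝ) : ℂ) • (inner ℂ x x • toOp (eval P μ) x) := by
      simp only [rankOnePerturbation, toOp, map_sub, map_smul, StarAlgEquiv.apply_symm_apply,
        sub_apply, smul_apply, rankOne_apply]
    rw [h2, smul_sub, smul_smul, smul_smul, inner_self_eq_norm_sq_to_K]
    congr 2
    calc _ = (w j / weight w μ : ℝ) * (μ ^ (j : ℕ) * (star (μ ^ (j : ℕ)) /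
            ((‖μ‖ ^ (j : ℕ) : ℝ) : ℂ))) * (((‖x‖ ^ 2)⁻¹ : ℝ) * (‖x‖ : ℂ) ^ 2) := by
          simp only [Complex.coe_algebraMap]; ring
      _ = _ := by
          rw [h1]
          push_cast
          field_simp
  rw [toOp_eval, Finset.sum_congr rfl fun j _ ↦ hj j, Finset.sum_sub_distrib, ← toOp_eval,
    ← Finset.sum_smul, ← Complex.ofReal_sum, ← Finset.sum_div]
  rw [show ∑ j : Fin (m + 1), w j * ‖μ‖ ^ (j : ℕ) = weight w μ from rfl, div_self hW]
  simp

theorem continuousOn_rankOnePerturbation (P : MPoly n m) (w : Fin (m + 1) → ℝ) (μ : ℂ) :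
    ContinuousOn (rankOnePerturbation P w μ) {0}ᶜ := by
  have hS : Continuous (toEuclideanCLM (n := Fin n) (𝕜 := ℂ)).symm :=
    LinearMap.continuous_of_finiteDimensional
      (toEuclideanCLM (n := Fin n) (𝕜 := ℂ)).symm.toAlgEquiv.toLinearEquiv.toLinearMap
  refine continuousOn_pi.2 fun j ↦ continuousOn_const.sub ?_
  apply ContinuousOn.fun_smul
  · refine continuousOn_const.mul ?_
    refine Complex.continuous_ofReal.comp_continuousOn ?_
    refine ContinuousOn.inv₀ (by fun_prop) fun x hx ↦ ?_
    simpa using hx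
  · refine (hS.comp ?_).continuousOn
    simp only [rankOne_def']
    exact ((ContinuousLinearMap.toSpanSingletonCLE (𝕜 := ℂ)).continuous.comp
      (toOp (eval P μ)).continuous).clm_comp (innerSL ℂ).continuous

/-- The admissible perturbations with the prescribed eigenvalue `μ` form a connected set. -/
theorem isPreconnected_setOf_det_eval_eq_zero {P : MPoly n m} {ε : ℝ} {w : Fin (m + 1) → ℝ}
    (hw : ∀ j, 0 ≤ w j) (hw0 : 0 < w 0) (hε : 0 ≤ ε) (μ : ℂ) :
    IsPreconnected {Q | Q ∈ ball P ε w ∧ (eval Q μ).det = 0} := by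
  -- For n = 0 the determinant is 1 and the set is empty.
  rcases subsingleton_or_nontrivial (EuclideanSpace ℂ (Fin n)) with hsub | hnt
  · convert isPreconnected_empty
    ext Q
    simp only [Set.mem_ofPred_eq, Set.mem_empty_iff_false, iff_false, not_and]
    intro _ h
    obtain ⟨x, hx, -⟩ := (det_eq_zero_iff_exists_toOp _).1 h
    exact hx (Subsingleton.elim _ _)
  have hW := weight_pos hw hw0 μ
  obtain ⟨v, hv, s, hmin, hre⟩ := exists_min_singular_vector (toOp (eval P μ))
  refine isPreconnected_of_forall (rankOnePerturbation P w μ v) ?_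
  rintro Q ⟨hQ, hQ0⟩
  obtain ⟨x, hx, hQx, hxv⟩ : ∃ x, x ≠ 0 ∧ toOp (eval Q μ) x = 0 ∧
      0 ≤ RCLike.re (inner ℂ x v) := by
    obtain ⟨x, hx, hQx⟩ := (det_eq_zero_iff_exists_toOp _).1 hQ0
    rcases le_total 0 (RCLike.re (inner ℂ x v)) with h | h
    · exact ⟨x, hx, hQx, h⟩
    · exact ⟨-x, neg_ne_zero.2 hx, by rw [map_neg, hQx, neg_zero], by
        rw [inner_neg_left, map_neg]; exact neg_nonneg.2 h⟩
  have hxr := norm_toOp_eval_le hQ hQx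
  have hseg : ∀ z ∈ segment ℝ x v,
      z ≠ 0 ∧ ‖toOp (eval P μ) z‖ ≤ ε * weight w μ * ‖z‖ := fun z hz ↦
    norm_apply_segment_le hv hmin hre hx hxv (by positivity) hxr hz
  -- Inside the convex set `K`, `Q` is joined to the rank-one perturbation built from `x`; sliding
  -- `x` to `v` then leads to a point independent of `Q`.
  let K : Set (MPoly n m) := {Q | Q ∈ ball P ε w ∧ toOp (eval Q μ) x = 0}
  have hK : IsPreconnected K := by
    refine Convex.isPreconnected ?_
    refine (convex_ball P ε w).inter (t := {Q : MPoly n m | toOp (eval Q μ) x = 0}) ?_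
    intro Q₁ h₁ Q₂ h₂ a b _ _ _
    simp only [Set.mem_ofPred_eq] at h₁ h₂ ⊢
    have : toOp (eval (a • Q₁ + b • Q₂) μ) x =
        (a : ℂ) • toOp (eval Q₁ μ) x + (b : ℂ) • toOp (eval Q₂ μ) x := by
      simp only [toOp_eval, Finset.smul_sum, ← Finset.sum_add_distrib]
      refine Finset.sum_congr rfl fun j _ ↦ ?_
      rw [Pi.add_apply, Pi.smul_apply, Pi.smul_apply, ← Complex.coe_smul, ← Complex.coe_smul]
      simp only [toOp, map_add, map_smul, add_apply,
        smul_apply, smul_add]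
      rw [smul_comm, smul_comm (b : ℂ)]
    rw [this, h₁, h₂, smul_zero, smul_zero, add_zero]
  have hD : IsPreconnected (rankOnePerturbation P w μ '' segment ℝ x v) :=
    (convex_segment x v).isPreconnected.image _
      ((continuousOn_rankOnePerturbation P w μ).mono fun z hz ↦ (hseg z hz).1)
  refine ⟨K ∪ rankOnePerturbation P w μ '' segment ℝ x v, ?_,
    .inr ⟨v, right_mem_segment ℝ x v, rfl⟩, .inl ⟨hQ, hQx⟩,
    hK.union (rankOnePerturbation P w μ x) ⟨rankOnePerturbation_mem_ball hw hw0 hx hxr,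
      toOp_eval_rankOnePerturbation hw hw0 hx⟩ ⟨x, left_mem_segment ℝ x v, rfl⟩ hD⟩
  rintro R (⟨hR, hRx⟩ | ⟨z, hz, rfl⟩)
  · exact ⟨hR, (det_eq_zero_iff_exists_toOp _).2 ⟨x, hx, hRx⟩⟩
  · obtain ⟨hz0, hzr⟩ := hseg z hz
    exact ⟨rankOnePerturbation_mem_ball hw hw0 hz0 hzr,
      (det_eq_zero_iff_exists_toOp _).2 ⟨z, hz0, toOp_eval_rankOnePerturbation hw hw0 hz0⟩⟩

end MatrixPoly

end

noncomputable section

namespace MatrixPoly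

open Topology unitInterval

variable {n m : ℕ}

/-! ### Counting eigenvalues in components of the pseudospectrum -/

theorem isCompact_pseudospectrum {P : MPoly n m} {ε : ℝ} {w : Fin (m + 1) → ℝ}
    (hbdd : Bornology.IsBounded (pseudospectrum P ε w)) : IsCompact (pseudospectrum P ε w) := by
  obtain ⟨R, hR⟩ := hbdd.subset_closedBall 0
  have hK : IsCompact ((ball P ε w ×ˢ Metric.closedBall (0 : ℂ) R) ∩
      {x | (eval x.1 x.2).det = 0}) :=
    ((isCompact_ball P ε w).prod (isCompact_closedBall _ _)).inter_right
      (isClosed_singleton.preimage continuous_det_eval)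
  have : pseudospectrum P ε w = Prod.snd '' ((ball P ε w ×ˢ Metric.closedBall (0 : ℂ) R) ∩
      {x : MPoly n m × ℂ | (eval x.1 x.2).det = 0}) := by
    ext z
    constructor
    · rintro ⟨Q, hQ, h⟩
      exact ⟨(Q, z), ⟨⟨hQ, hR ⟨Q, hQ, h⟩⟩, h⟩, rfl⟩
    · rintro ⟨⟨Q, z⟩, ⟨⟨hQ, -⟩, h⟩, rfl⟩
      exact ⟨Q, hQ, h⟩
  rw [this]
  exact hK.image continuous_snd

/-- The admissible perturbations together with an enumeration of their eigenvalues. -/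
def rootSpace (P : MPoly n m) (ε : ℝ) (w : Fin (m + 1) → ℝ) :
    Set (ball P ε w × (Fin (n * m) → pseudospectrum P ε w)) :=
  {t | IsRootVector (t.1 : MPoly n m) fun i ↦ (t.2 i : ℂ)}

theorem isClosed_rootSpace (P : MPoly n m) (ε : ℝ) (w : Fin (m + 1) → ℝ) :
    IsClosed (rootSpace P ε w) := by
  simp only [rootSpace, IsRootVector, Set.ofPred_forall]
  refine isClosed_iInter fun z ↦ isClosed_eq ?_ ?_
  · exact continuous_det_eval.comp (f := fun t : ball P ε w × (Fin (n * m) → pseudospectrum P ε w) ↦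
      ((t.1 : MPoly n m), z)) (by fun_prop)
  · refine Continuous.mul (Continuous.matrix_det ?_) (by fun_prop)
    exact (continuous_apply _).comp (continuous_subtype_val.comp continuous_fst)

section Bounded

variable {P : MPoly n m} {ε : ℝ} {w : Fin (m + 1) → ℝ}

theorem exists_rootSpace (hP : (P (Fin.last m)).det ≠ 0) (hw : ∀ j, 0 ≤ w j) (hε : 0 ≤ ε)
    (hbdd : Bornology.IsBounded (pseudospectrum P ε w)) (Q : ball P ε w) :
    ∃ t : rootSpace P ε w, t.1.1 = Q := by
  have hQ := det_last_ne_zero_of_isBounded hP hw hε hbdd Q.2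
  obtain ⟨r, hr⟩ := exists_isRootVector hQ
  exact ⟨⟨(Q, fun i ↦ ⟨r i, Q, Q.2, (hr.det_eval_eq_zero_iff hQ _).2 ⟨i, rfl⟩⟩), hr⟩, rfl⟩

theorem compactSpace_rootSpace (hbdd : Bornology.IsBounded (pseudospectrum P ε w)) :
    CompactSpace (rootSpace P ε w) := by
  have := isCompact_iff_compactSpace.1 (isCompact_pseudospectrum hbdd)
  have := isCompact_iff_compactSpace.1 (isCompact_ball P ε w)
  exact isCompact_iff_compactSpace.1 (isClosed_rootSpace P ε w).isCompact

/-- Eigenvalues move continuously inside the pseudospectrum, so none can enter or leave a clopen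
part as `Q` varies over the connected ball. -/
theorem numEigenvalues_eq_of_isClopen (hP : (P (Fin.last m)).det ≠ 0) (hw : ∀ j, 0 ≤ w j)
    (hε : 0 ≤ ε) (hbdd : Bornology.IsBounded (pseudospectrum P ε w))
    {C : Set (pseudospectrum P ε w)} (hC : IsClopen C) {Q : MPoly n m} (hQ : Q ∈ ball P ε w) :
    numEigenvalues Q (Subtype.val '' C) = numEigenvalues P (Subtype.val '' C) := by
  classical
  have := compactSpace_rootSpace hbdd
  have hpre : PreconnectedSpace (ball P ε w) :=
    Subtype.preconnectedSpace (convex_ball P ε w).isPreconnected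
  let N : ball P ε w → ℕ := fun Q ↦
    ((detPoly (Q : MPoly n m)).roots.filter (· ∈ Subtype.val '' C)).card
  have hdet : ∀ Q ∈ ball P ε w, (Q (Fin.last m)).det ≠ 0 := fun Q hQ ↦
    det_last_ne_zero_of_isBounded hP hw hε hbdd hQ
  have key := apply_eq_of_sum_indicator_branches (T := rootSpace P ε w) (X := ball P ε w)
    (q := fun t ↦ t.1.1) (ρ := fun i t ↦ t.1.2 i) (N := N) (by fun_prop) (fun i ↦ by fun_prop)
    (exists_rootSpace hP hw hε hbdd) hC (fun t ↦ ?_) ⟨Q, hQ⟩ ⟨P, mem_ball_self P hε hw⟩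
  · rw [numEigenvalues_eq_card (hdet Q hQ), numEigenvalues_eq_card hP]
    exact congrArg _ key
  · have ht : IsRootVector (t.1.1 : MPoly n m) fun i ↦ (t.1.2 i : ℂ) := t.2
    simp only [N]
    rw [ht.roots_eq (hdet _ t.1.1.2), Multiset.filter_map, Multiset.card_map]
    simp only [Set.indicator_apply, Pi.one_apply]
    rw [← Finset.card_filter]
    simp [Finset.card, Finset.filter]

theorem numEigenvalues_mono {Q : MPoly n m} (hQ : (Q (Fin.last m)).det ≠ 0) {G C : Set ℂ}
    (h : ∀ z ∈ G, (eval Q z).det = 0 → z ∈ C) : numEigenvalues Q G ≤ numEigenvalues Q C := by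
  obtain ⟨r, hr⟩ := exists_isRootVector hQ
  rw [hr.numEigenvalues_eq hQ, hr.numEigenvalues_eq hQ, Nat.cast_le]
  refine Finset.card_le_card fun i hi ↦ ?_
  simp only [Finset.mem_filter, Finset.mem_univ, true_and] at hi ⊢
  exact h _ hi ((hr.det_eval_eq_zero_iff hQ _).2 ⟨i, rfl⟩)

theorem algMult_le_numEigenvalues {Q : MPoly n m} (hQ : (Q (Fin.last m)).det ≠ 0) {G : Set ℂ}
    {z : ℂ} (hz : z ∈ G) : algMult Q z ≤ numEigenvalues Q G := by
  have h : numEigenvalues Q {z} = algMult Q z := tsum_singleton z (algMult Q)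
  rw [← h]
  exact numEigenvalues_mono hQ fun y hy _ ↦ (Set.mem_singleton_iff.1 hy) ▸ hz

/-- If an admissible perturbation has a multiple eigenvalue in the component, then `P` has more
than one eigenvalue there. -/
theorem one_lt_numEigenvalues_of_isMultipleEigenvalue (hP : (P (Fin.last m)).det ≠ 0)
    (hw : ∀ j, 0 ≤ w j) (hε : 0 ≤ ε) (hbdd : Bornology.IsBounded (pseudospectrum P ε w))
    (x : pseudospectrum P ε w) {Q : MPoly n m} (hQ : Q ∈ ball P ε w) {z : ℂ}
    (hz : z ∈ Subtype.val '' connectedComponent x) (hmult : IsMultipleEigenvalue Q z) :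
    1 < numEigenvalues P (Subtype.val '' connectedComponent x) := by
  have := isCompact_iff_compactSpace.1 (isCompact_pseudospectrum hbdd)
  -- The finitely many eigenvalues of `P` outside the component are to be kept out of `C`.
  let K : Set (pseudospectrum P ε w) := {y | (eval P y).det = 0} \ connectedComponent x
  have hfin : K.Finite := by
    refine Set.Finite.subset (s := Subtype.val ⁻¹' ((detPoly P).roots.toFinset : Set ℂ)) ?_ ?_
    · exact (Finset.finite_toSet _).preimage Subtype.val_injective.injOn
    · rintro y ⟨hy, -⟩
      have hy' : (eval P y).det = 0 := hy
      simpa [detPoly_ne_zero hP, eval_detPoly] using hy'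
  obtain ⟨C, hC, hsub, hdisj⟩ := exists_isClopen_of_disjoint_connectedComponent (x := x)
    hfin.isClosed Set.disjoint_sdiff_left
  calc 1 < algMult Q z := hmult
    _ ≤ numEigenvalues Q (Subtype.val '' C) :=
      algMult_le_numEigenvalues (det_last_ne_zero_of_isBounded hP hw hε hbdd hQ)
        (Set.image_mono hsub hz)
    _ = numEigenvalues P (Subtype.val '' C) :=
      numEigenvalues_eq_of_isClopen hP hw hε hbdd hC hQ
    _ ≤ numEigenvalues P (Subtype.val '' connectedComponent x) := by
      refine numEigenvalues_mono hP ?_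
      rintro _ ⟨y, hy, rfl⟩ hdet
      by_contra h
      exact Set.disjoint_left.1 hdisj ⟨hdet, fun hy' ↦ h ⟨y, hy', rfl⟩⟩ hy

/-- The pairs of an admissible perturbation and one of its eigenvalues in a connected component of
the pseudospectrum form a connected set. -/
theorem isPreconnected_eigenpairs (hw : ∀ j, 0 ≤ w j) (hw0 : 0 < w 0) (hε : 0 ≤ ε)
    (hbdd : Bornology.IsBounded (pseudospectrum P ε w)) (x : pseudospectrum P ε w) :
    IsPreconnected {e : ball P ε w × pseudospectrum P ε w |
      (eval (e.1 : MPoly n m) e.2).det = 0 ∧ e.2 ∈ connectedComponent x} := by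
  have := isCompact_iff_compactSpace.1 (isCompact_pseudospectrum hbdd)
  have := isCompact_iff_compactSpace.1 (isCompact_ball P ε w)
  let S : Set (ball P ε w × pseudospectrum P ε w) := {e | (eval (e.1 : MPoly n m) e.2).det = 0}
  have hS : IsClosed S := isClosed_singleton.preimage
    (continuous_det_eval.comp (f := fun e : ball P ε w × pseudospectrum P ε w ↦
      ((e.1 : MPoly n m), (e.2 : ℂ))) (by fun_prop))
  have hScompact : CompactSpace S := isCompact_iff_compactSpace.1 hS.isCompact
  let f : S → pseudospectrum P ε w := fun e ↦ e.1.2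
  have hf : Continuous f := by fun_prop
  have hsurj : Function.Surjective f := by
    rintro ⟨z, Q, hQ, h⟩
    exact ⟨⟨(⟨Q, hQ⟩, ⟨z, Q, hQ, h⟩), h⟩, rfl⟩
  have hfib : ∀ z, IsConnected (f ⁻¹' {z}) := by
    intro z
    refine ⟨?_, ?_⟩
    · obtain ⟨e, he⟩ := hsurj z
      exact ⟨e, he⟩
    let F : Set (MPoly n m) := {Q | Q ∈ ball P ε w ∧ (eval Q z).det = 0}
    have hF : PreconnectedSpace F := Subtype.preconnectedSpace
      (isPreconnected_setOf_det_eval_eq_zero hw hw0 hε z)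
    let g : F → S := fun Q ↦ ⟨(⟨Q, Q.2.1⟩, z), Q.2.2⟩
    have hg : Continuous g := by fun_prop
    convert isPreconnected_range hg
    ext ⟨⟨Q, y⟩, h⟩
    constructor
    · rintro (rfl : y = z)
      exact ⟨⟨Q, Q.2, h⟩, rfl⟩
    · rintro ⟨R, hR⟩
      rw [← hR]
      rfl
  -- For a quotient map with connected fibres, the preimage of a closed connected set is connected.
  have hq := (hf.isClosedMap.isQuotientMap hf hsurj).isCoinducing
  have hconn := hq.isConnected_preimage_of_isClosed hfib isClosed_connectedComponent
    (isConnected_connectedComponent (x := x))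
  convert hconn.isPreconnected.image Subtype.val continuous_subtype_val.continuousOn
  ext e
  constructor
  · rintro ⟨h1, h2⟩
    exact ⟨⟨e, h1⟩, h2, rfl⟩
  · rintro ⟨e', h, rfl⟩
    exact ⟨e'.2, h⟩

/-- If no admissible perturbation has a multiple eigenvalue in the component, then the eigenvalues
of `P` in the component coincide. -/
theorem eq_of_forall_not_isMultipleEigenvalue (hP : (P (Fin.last m)).det ≠ 0)
    (hw : ∀ j, 0 ≤ w j) (hw0 : 0 < w 0) (hε : 0 ≤ ε)
    (hbdd : Bornology.IsBounded (pseudospectrum P ε w)) (x : pseudospectrum P ε w)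
    (hsimple : ∀ Q ∈ ball P ε w, ∀ z ∈ connectedComponent x, ¬ IsMultipleEigenvalue Q (z : ℂ))
    {a b : pseudospectrum P ε w} (ha : a ∈ connectedComponent x) (hb : b ∈ connectedComponent x)
    (hPa : (eval P a).det = 0) (hPb : (eval P b).det = 0) : a = b := by
  have := isCompact_iff_compactSpace.1 (isCompact_pseudospectrum hbdd)
  have := compactSpace_rootSpace hbdd
  let q : rootSpace P ε w → ball P ε w := fun t ↦ t.1.1
  let ρ : Fin (n * m) → rootSpace P ε w → pseudospectrum P ε w := fun i t ↦ t.1.2 i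
  have hq : Continuous q := by fun_prop
  have hρ : ∀ i, Continuous (ρ i) := fun i ↦ by fun_prop
  have hsurj : Function.Surjective q := exists_rootSpace hP hw hε hbdd
  have hiff : ∀ (t : rootSpace P ε w) (z : pseudospectrum P ε w),
      (eval (q t : MPoly n m) z).det = 0 ↔ ∃ i, ρ i t = z := fun t z ↦ by
    have ht : IsRootVector (q t : MPoly n m) fun i ↦ (ρ i t : ℂ) := t.2
    rw [ht.det_eval_eq_zero_iff (det_last_ne_zero_of_isBounded hP hw hε hbdd (q t).2)]
    simp [Subtype.ext_iff]
  -- `M` collects the values at which two entries of an enumeration coincide, that is, the multiple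
  -- eigenvalues.
  let M : Set (pseudospectrum P ε w) :=
    ⋃ z : {z : Fin (n * m) × Fin (n * m) // z.1 ≠ z.2}, ρ z.1.1 '' {t | ρ z.1.1 t = ρ z.1.2 t}
  have hM : IsClosed M := isClosed_iUnion_of_finite fun z ↦
    ((isClosed_eq (hρ _) (hρ _)).isCompact.image (hρ _)).isClosed
  have hMx : Disjoint M (connectedComponent x) := by
    rw [Set.disjoint_left]
    intro y hy hyx
    obtain ⟨⟨⟨i, j⟩, hij⟩, t, ht, rfl⟩ := Set.mem_iUnion.1 hy
    have hr : IsRootVector (q t : MPoly n m) fun i ↦ (ρ i t : ℂ) := t.2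
    exact hsimple _ (q t).2 _ hyx (hr.isMultipleEigenvalue hij (congrArg Subtype.val ht))
  obtain ⟨C, hC, hsub, hdisj⟩ := exists_isClopen_of_disjoint_connectedComponent hM hMx
  have cov := isCoveringMap_branchGraph hq hρ hsurj
    (fun t t' i h ↦ (hiff t' _).1 (h ▸ (hiff t _).2 ⟨i, rfl⟩)) hC
    (fun t i j hij h ↦ Set.disjoint_left.1 hdisj (Set.mem_iUnion.2 ⟨⟨(i, j), hij⟩, t, h, rfl⟩))
  have hmem : ∀ e : ball P ε w × pseudospectrum P ε w, (eval (e.1 : MPoly n m) e.2).det = 0 →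
      e.2 ∈ connectedComponent x → e ∈ branchGraph q ρ C := fun e h1 h2 ↦ by
    obtain ⟨t, ht⟩ := hsurj e.1
    obtain ⟨i, hi⟩ := (hiff t e.2).1 (ht ▸ h1)
    exact ⟨⟨t, i, ht, hi⟩, hsub h2⟩
  let P₀ : ball P ε w := ⟨P, mem_ball_self P hε hw⟩
  let H : C(I × ball P ε w, ball P ε w) :=
    ⟨fun z ↦ ⟨AffineMap.lineMap (z.2 : MPoly n m) P (z.1 : ℝ),
      (convex_ball P ε w).lineMap_mem z.2.2 P₀.2 z.1.2⟩, by
        refine Continuous.subtype_mk ?_ _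
        simp only [AffineMap.lineMap_apply]
        fun_prop⟩
  let S : Set (branchGraph q ρ C) := Subtype.val ⁻¹' {e : ball P ε w × pseudospectrum P ε w |
      (eval (e.1 : MPoly n m) e.2).det = 0 ∧ e.2 ∈ connectedComponent x}
  have hS : IsPreconnected S := by
    rw [← IsInducing.subtypeVal.isPreconnected_image, Subtype.image_preimage_coe,
      Set.inter_eq_self_of_subset_right fun e he ↦ hmem e he.1 he.2]
    exact isPreconnected_eigenpairs hw hw0 hε hbdd x
  have key := eq_of_isPreconnected_of_isCoveringMap cov H (x₀ := P₀)
    (fun Q ↦ Subtype.ext (AffineMap.lineMap_apply_zero _ _))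
    (fun Q ↦ Subtype.ext (AffineMap.lineMap_apply_one _ _))
    (fun t ↦ Subtype.ext (AffineMap.lineMap_same_apply _ _)) hS
    (a := ⟨(P₀, a), hmem _ hPa ha⟩) (b := ⟨(P₀, b), hmem _ hPb hb⟩) ⟨hPa, ha⟩ ⟨hPb, hb⟩ rfl rfl
  exact congrArg (fun e ↦ e.1.2) key

/-- If `P` has more than one eigenvalue in the component, then some admissible perturbation has a
multiple eigenvalue there. -/
theorem exists_isMultipleEigenvalue_of_one_lt_numEigenvalues (hP : (P (Fin.last m)).det ≠ 0)
    (hw : ∀ j, 0 ≤ w j) (hw0 : 0 < w 0) (hε : 0 ≤ ε)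
    (hbdd : Bornology.IsBounded (pseudospectrum P ε w)) (x : pseudospectrum P ε w)
    (h : 1 < numEigenvalues P (Subtype.val '' connectedComponent x)) :
    ∃ Q ∈ ball P ε w, ∃ z ∈ connectedComponent x, IsMultipleEigenvalue Q (z : ℂ) := by
  by_contra! hsimple
  obtain ⟨r, hr⟩ := exists_isRootVector hP
  rw [hr.numEigenvalues_eq hP, Nat.one_lt_cast, Finset.one_lt_card] at h
  obtain ⟨i, hi, j, hj, hij⟩ := h
  simp only [Finset.mem_filter, Finset.mem_univ, true_and] at hi hj
  obtain ⟨a, ha, hai⟩ := hi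
  obtain ⟨b, hb, hbj⟩ := hj
  have hab := eq_of_forall_not_isMultipleEigenvalue hP hw hw0 hε hbdd x hsimple ha hb
    ((hr.det_eval_eq_zero_iff hP _).2 ⟨i, hai.symm⟩)
    ((hr.det_eval_eq_zero_iff hP _).2 ⟨j, hbj.symm⟩)
  -- Distinct indices `i` and `j` now carry the same root, so `P` itself would have a multiple
  -- eigenvalue.
  refine hsimple P (mem_ball_self P hε hw) a ha ?_
  rw [hai]
  exact hr.isMultipleEigenvalue hij (by rw [← hai, ← hbj, hab])

end Bounded

end MatrixPoly

end

theorem mainTheorem4 (n m : ℕ) (P : MatrixPoly.MPoly n m) (hP : (P (Fin.last m)).det ≠ 0)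
    (w : Fin (m + 1) → ℝ) (hw : ∀ j, 0 ≤ w j) (hw0 : 0 < w 0)
    (ε : ℝ) (hε : 0 ≤ ε)
    (hbdd : Bornology.IsBounded (MatrixPoly.pseudospectrum P ε w))
    (G : Set ℂ) (hG : MatrixPoly.IsComponentOf G (MatrixPoly.pseudospectrum P ε w)) :
    1 < MatrixPoly.numEigenvalues P G ↔
      ∃ Q ∈ MatrixPoly.ball P ε w, ∃ μ ∈ G, MatrixPoly.IsMultipleEigenvalue Q μ := by
  obtain ⟨x, hx, rfl⟩ := hG
  rw [connectedComponentIn_eq_image hx]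
  constructor
  · intro h
    obtain ⟨Q, hQ, z, hz, hmult⟩ :=
      MatrixPoly.exists_isMultipleEigenvalue_of_one_lt_numEigenvalues hP hw hw0 hε hbdd ⟨x, hx⟩ h
    exact ⟨Q, hQ, z, ⟨z, hz, rfl⟩, hmult⟩
  · rintro ⟨Q, hQ, z, hz, hmult⟩
    exact MatrixPoly.one_lt_numEigenvalues_of_isMultipleEigenvalue hP hw hε hbdd ⟨x, hx⟩ hQ hz hmult
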